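/- **Theorem (consistency of the $L_0$-fused group lasso with a diverging number of parameters).** For every sample size $n$ consider a logistic regression model with $J_n$ categorical covariates, the $j$-th of which has levels $0,\dots,p_{n,j}$ ($0$ is the reference level), with or without an intercept. Put $p_n=\sum_{j\le J_n}p_{n,j}$. The coefficient vector $\beta$ consists of the $\beta_{j,k}$, $1\le k\le p_{n,j}$, and of the intercept $\beta_0$ if there is one; $\beta_{j,0}:=0$ and $\beta_j:=(\beta_{j,1},\dots,\beta_{j,p_{n,j}})$. The row vector $x$ consists of the dummy variables $x_{j,k}=1\{X_j=k\}$, $k\ge 1$ (preceded by a $1$ if there is an intercept). The observations $v_i=(y_i,x_i)$, $i=1,\dots,n$, are iid, where the law of $x_i$ is arbitrary and may depend on $n$, and $y_i\in\{0,1\}$ has the conditional density $f_n(v,\beta)=\exp(y\,x\beta-\varphi(x\beta))$, $\varphi(\eta)=\log(1+e^\eta)$, at the true parameter $\beta=\beta^*=\beta^*_n$. Let $L_n(\beta)=\sum_{i=1}^n\log f_n(v_i,\beta)$. For $\lambda_n^1,\lambda_n^0\ge 0$ and weights $w_1^{(j)}\ge 0$, $w_0^{(j,rs)}\ge 0$ (all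 of which may depend on $n$ and on the sample) let $$M_{pen}(\beta)=-L_n(\beta)+\lambda_n^1\sum_{j=1}^{J_n}w_1^{(j)}\|\beta_j\|_2+\lambda_n^0\sum_{j=1}^{J_n}\ \sum_{0\le r<s\le p_{n,j}}w_0^{(j,rs)}\,1\{\beta_{j,r}\ne\beta_{j,s}\},$$ $$a_n^1=\max_{j}\lambda_n^1w_1^{(j)},\qquad a_n^0=\max_{j}\max_{0\le r<s\le p_{n,j}}\lambda_n^0w_0^{(j,rs)},\qquad \alpha_n=\sqrt{p_n/n}$$ (a maximum over the empty set is $0$). An $L_0$-FGL estimator is a function $\hat\beta_n$ of the sample that is a global minimizer of $M_{pen}$ whenever $M_{pen}$ has one. Let $I_F(\beta^*_n)$ be the Fisher information matrix of one observation, $[I_F(\beta)]_{a,b}=E_\beta\big(\partial_a\log f_n(v_1,\beta)\,\partial_b\log f_n(v_1,\beta)\big)$. Assume that it is positive definite uniformly in $n$, i.e. that there is a $\kappa>0$ with $u^TI_F(\beta_n^*)u\ge\kappa\|u\|_2^2$ for all $n$ and $u$. (In this model the Fisher information is always finite, and the third derivatives of $\log f_n$ are always bounded by $1$.) Assume moreover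 that, for some constants $c_1,c_2>0$, $$\alpha_na_n^1J_n\to c_1,\qquad a_n^0\,p_n(p_n-1)\to c_2\quad\text{in probability},\qquad \frac{p_n^4}{n}\to 0$$ (for deterministic tuning parameters and weights the first two are ordinary limits). Then there is an $L_0$-FGL estimator $\hat\beta_n$ such that the probability that $\hat\beta_n$ minimizes $M_{pen}$ (in particular, that a minimizer exists) tends to $1$, and $$\|\hat\beta_n-\beta^*_n\|_2=O_p(\alpha_n)=O_p\big(\sqrt{p_n/n}\big).$$ -/

import Mathlib

open Filter Topology MeasureTheory

noncomputable section

namespace L0FGL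

/-- The layout of a regression on categorical factors: `J` factors, the `j`-th one having the
`p j + 1` levels `0, …, p j` (level `0` is the reference category), and possibly an intercept. -/
structure Design where
  J : ℕ
  p : Fin J → ℕ
  intercept : Bool

namespace Design

variable (D : Design)

/-- `p = ∑ j, p j`, the number of non-reference levels of all factors. -/
def numLevels : ℕ := ∑ j, D.p j

/-- Index set of the regression coefficients: one for the intercept if there is one, and one for
each non-reference level of each factor; `⟨j, k⟩` stands for the level `k + 1` of factor `j`. -/
abbrev Idx : Type := Fin D.intercept.toNat ⊕ (Σ j : Fin D.J, Fin (D.p j))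

/-- Coefficient vectors `β`, with the Euclidean norm. -/
abbrev Params : Type := EuclideanSpace ℝ D.Idx

/-- Values of the covariates: a level for each factor. -/
abbrev Covariates : Type := (j : Fin D.J) → Fin (D.p j + 1)

/-- An observation `v = (y, x)` with a binary response. -/
abbrev Obs : Type := Fin 2 × D.Covariates

/-- A sample of size `n`. -/
abbrev Sample (n : ℕ) : Type := Fin n → D.Obs

end Design

variable {D : Design}

/-- The row of the design matrix that belongs to the covariate values `x` (dummy coding). -/
def row (x : D.Covariates) : D.Idx → ℝ
  | Sum.inl _ => 1
  | Sum.inr ⟨j, k⟩ => if x j = k.succ then 1 else 0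

/-- The linear predictor `x β`. -/
def linPred (β : D.Params) (x : D.Covariates) : ℝ := ∑ a, row x a * β a

/-- The response as a real number. -/
def resp (v : D.Obs) : ℝ := ((v.1 : ℕ) : ℝ)

/-- `φ(η) = log (1 + exp η)`. -/
def phi (η : ℝ) : ℝ := Real.log (1 + Real.exp η)

/-- The density `f(v, β) = exp (y x β - φ(x β))` of the logistic regression model, with respect to
the product of the counting measure (for `y`) and the law of the covariates (for `x`). -/
def density (β : D.Params) (v : D.Obs) : ℝ :=
  Real.exp (resp v * linPred β v.2 - phi (linPred β v.2))

/-- The law of one observation when the covariates have law `μ` and the parameter is `β`. -/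
def obsLaw (μ : Measure D.Covariates) (β : D.Params) : Measure D.Obs :=
  ((Measure.count : Measure (Fin 2)).prod μ).withDensity fun v => ENNReal.ofReal (density β v)

/-- The law of `n` independent observations. -/
def sampleLaw (μ : Measure D.Covariates) (β : D.Params) (n : ℕ) : Measure (D.Sample n) :=
  Measure.pi fun _ => obsLaw μ β

/-- The log likelihood `L_n(β)` of a sample. -/
def logLik {n : ℕ} (d : D.Sample n) (β : D.Params) : ℝ := ∑ i, Real.log (density β (d i))

/-- The partial derivative of `log f(v, ·)` at `β` in the coordinate `a`. -/
def score (β : D.Params) (v : D.Obs) (a : D.Idx) : ℝ :=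
  fderiv ℝ (fun b : D.Params => Real.log (density b v)) β (EuclideanSpace.single a 1)

/-- The Fisher information matrix of one observation. All functions on the finite space `D.Obs` are
integrable, so that its entries are always genuine expectations. -/
def fisherInfo (μ : Measure D.Covariates) (β : D.Params) : Matrix D.Idx D.Idx ℝ :=
  Matrix.of fun a b => ∫ v, score β v a * score β v b ∂(obsLaw μ β)

/-- The coefficient of level `r` of factor `j`; it is `0` for the reference level. -/
def coef (β : D.Params) (j : Fin D.J) (r : Fin (D.p j + 1)) : ℝ :=
  Fin.cases (motive := fun _ => ℝ) 0 (fun k => β (Sum.inr ⟨j, k⟩)) r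

/-- The Euclidean norm of the block `β_j` of the coefficients of factor `j`. -/
def groupNorm (β : D.Params) (j : Fin D.J) : ℝ :=
  Real.sqrt (∑ k : Fin (D.p j), β (Sum.inr ⟨j, k⟩) ^ 2)

/-- The `ℓ₀` norm of a real number. -/
def l0 (t : ℝ) : ℝ := if t = 0 then 0 else 1

/-- Tuning parameters and weights of the penalty; `w0 j r s` is used for `r < s` only. -/
structure Tuning (D : Design) where
  lam1 : ℝ
  lam0 : ℝ
  w1 : Fin D.J → ℝ
  w0 : (j : Fin D.J) → Fin (D.p j + 1) → Fin (D.p j + 1) → ℝ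
  lam1_nonneg : 0 ≤ lam1
  lam0_nonneg : 0 ≤ lam0
  w1_nonneg : ∀ j, 0 ≤ w1 j
  w0_nonneg : ∀ j r s, r < s → 0 ≤ w0 j r s

/-- The `L₀`-fused group lasso penalty. The second sum runs over all pairs of levels of a factor,
those with the reference level included; the intercept is not penalized. -/
def penalty (T : Tuning D) (β : D.Params) : ℝ :=
  T.lam1 * ∑ j, T.w1 j * groupNorm β j +
    T.lam0 * ∑ j, ∑ r : Fin (D.p j + 1), ∑ s ∈ Finset.Ioi r,
      T.w0 j r s * l0 (coef β j r - coef β j s)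

/-- The objective function `M_pen(β) = -L_n(β) + P_λ(β)`. -/
def objective {n : ℕ} (T : Tuning D) (d : D.Sample n) (β : D.Params) : ℝ :=
  -logLik d β + penalty T β

/-- The set of (global) minimizers of the objective function, i.e. of `L₀`-FGL estimates. -/
def argmins {n : ℕ} (T : Tuning D) (d : D.Sample n) : Set D.Params :=
  {β | ∀ b, objective T d β ≤ objective T d b}

/-- `a¹ = max {λ₁ w₁⁽ʲ⁾ ; j}` (`0` if there is no factor). -/
def a1 (T : Tuning D) : ℝ := ⨆ j, T.lam1 * T.w1 j

/-- `a⁰ = max {λ₀ w₀⁽ʲʳˢ⁾ ; 0 ≤ r < s ≤ p j, j}` (`0` if there is no such pair). -/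
def a0 (T : Tuning D) : ℝ :=
  ⨆ q : {q : Σ j : Fin D.J, Fin (D.p j + 1) × Fin (D.p j + 1) // q.2.1 < q.2.2},
    T.lam0 * T.w0 q.1.1 q.1.2.1 q.1.2.2

/-- `X n → c` in probability, where `X n` is a random variable on its own space `(Ω n, P n)`. -/
def TendstoInProb {Ω : ℕ → Type*} [∀ n, MeasurableSpace (Ω n)] (P : ∀ n, Measure (Ω n))
    (X : ∀ n, Ω n → ℝ) (c : ℝ) : Prop :=
  ∀ ε > 0, Tendsto (fun n => P n {ω | ε ≤ |X n ω - c|}) atTop (𝓝 0)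

/-- `X n = O_p(r n)`, where `X n` is a random variable on its own space `(Ω n, P n)`. -/
def IsBigOInProb {Ω : ℕ → Type*} [∀ n, MeasurableSpace (Ω n)] (P : ∀ n, Measure (Ω n))
    (X : ∀ n, Ω n → ℝ) (r : ℕ → ℝ) : Prop :=
  ∀ ε : ℝ, 0 < ε → ∃ C : ℝ, ∀ᶠ n in atTop, P n {ω | C * r n < |X n ω|} ≤ ENNReal.ofReal ε

end L0FGL

end

open L0FGL

/-! The objective splits as `G + P`. Here `G` (negative log likelihood plus group lasso) is convex
and continuous, and `P` (the `L₀` fusion term) is nonnegative, lower semicontinuous and bounded, but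
neither convex nor continuous. If `G(β*) + P(β*) < G(β* + u)` on a sphere `‖u‖ = r`, convexity
carries the inequality to everything outside the ball. Since `P ≥ 0`, no point out there can then
minimize `G + P`, and lower semicontinuity on the compact ball supplies a minimizer
(`exists_isMinOn_of_sphere`). Existence and rate thus come from one inequality on a sphere of radius
`r = C √(p/n)`.

That inequality rests on a quadratic lower bound for the logistic loss (`phi_add_quadratic_le`),
which replaces a third-order Taylor expansion: as long as `|x u| ≤ 1`, the loss exceeds its
linearization by an eighth of the observed information form. Chebyshev's inequality puts the score
within `K √(np)` and the observed information within `nκ/2` of its mean in Frobenius norm, so the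
quadratic gain is at least `nκr²/16`. With `r = C √(p/n)` the gain is `κC²p/16`, against losses
`KCp` (score), `2c₁C` (group lasso) and `6c₂` (fusion); a large `C` wins. Both `|x u| ≤ 1` and the
control of the information need only `p²/n → 0`, which follows from `p⁴/n → 0`. -/

noncomputable section

namespace L0FGL

/-! ### Scalar bounds for the logistic loss. -/

section Scalar

lemma one_add_add_sq_div_four_le_exp {x : ℝ} (hx : |x| ≤ 1) :
    1 + x + x ^ 2 / 4 ≤ Real.exp x := by
  have h := Real.exp_bound hx (n := 3) (by norm_num)
  have h2 := (abs_le.1 h).1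
  norm_num [Finset.sum_range_succ, Nat.factorial] at h2
  have h3 : |x| ^ 3 ≤ x ^ 2 := by
    rw [← sq_abs]
    nlinarith [sq_nonneg |x|, abs_nonneg x]
  nlinarith [sq_nonneg x]

lemma half_le_log_one_add {z : ℝ} (h0 : 0 ≤ z) (h1 : z ≤ 1) : z / 2 ≤ Real.log (1 + z) := by
  have h := Real.one_sub_inv_le_log_of_pos (x := 1 + z) (by linarith)
  refine le_trans ?_ h
  have : 1 - (1 + z)⁻¹ = z / (1 + z) := by field_simp; ring
  rw [this]
  exact div_le_div_of_nonneg_left h0 (by linarith) (by linarith)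

/-- The increment of `phi` is the log moment generating function of a Bernoulli variable with mean
`sigmoid η`. -/
lemma phi_add (η t : ℝ) :
    phi (η + t) =
      phi η + Real.log (1 - Real.sigmoid η + Real.sigmoid η * Real.exp t) := by
  have h1 : (0 : ℝ) < 1 + Real.exp η := by positivity
  have h2 : 0 < 1 - Real.sigmoid η + Real.sigmoid η * Real.exp t := by
    have := Real.sigmoid_lt_one η
    have := Real.sigmoid_pos η
    have := mul_pos this (Real.exp_pos t)
    linarith
  rw [phi, phi, ← Real.log_mul h1.ne' h2.ne']
  congr 1
  rw [Real.sigmoid_def, Real.exp_neg, Real.exp_add]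
  field_simp
  ring

/-- Centring the Bernoulli variable: the factor `exp (s * t)` yields the linear term, and the
remaining mixture has exponents of mean zero. -/
lemma exp_shift_mixture (s t : ℝ) :
    1 - s + s * Real.exp t =
      Real.exp (s * t) * ((1 - s) * Real.exp (-(s * t)) + s * Real.exp ((1 - s) * t)) := by
  have h : Real.exp t = Real.exp (s * t) * Real.exp ((1 - s) * t) := by
    rw [← Real.exp_add]; ring_nf
  have h2 : Real.exp (s * t) * Real.exp (-(s * t)) = 1 := by
    rw [← Real.exp_add]; simp
  rw [h]
  linear_combination -(1 - s) * h2

lemma phi_add_tangent_le (η t : ℝ) : phi η + Real.sigmoid η * t ≤ phi (η + t) := by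
  rw [phi_add, exp_shift_mixture]
  set s := Real.sigmoid η
  have hs0 : 0 < s := Real.sigmoid_pos η
  have hs1 : s < 1 := Real.sigmoid_lt_one η
  have h : 1 ≤ (1 - s) * Real.exp (-(s * t)) + s * Real.exp ((1 - s) * t) := by
    nlinarith [mul_le_mul_of_nonneg_left (Real.add_one_le_exp (-(s * t))) (sub_nonneg.2 hs1.le),
      mul_le_mul_of_nonneg_left (Real.add_one_le_exp ((1 - s) * t)) hs0.le]
  rw [Real.log_mul (Real.exp_pos _).ne' (by linarith), Real.log_exp]
  linarith [Real.log_nonneg h]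

/-- The centred exponents have mean `0` and variance `s(1-s)t²`, so averaging `1 + x + x²/4 ≤ exp x`
bounds the mixture below by `1 + s(1-s)t²/4`; then `log (1 + z) ≥ z/2` costs another factor `2`. -/
lemma phi_add_quadratic_le (η : ℝ) {t : ℝ} (ht : |t| ≤ 1) :
    phi η + Real.sigmoid η * t + Real.sigmoid η * (1 - Real.sigmoid η) * t ^ 2 / 8 ≤
      phi (η + t) := by
  rw [phi_add, exp_shift_mixture]
  set s := Real.sigmoid η
  have hs0 : 0 < s := Real.sigmoid_pos η
  have hs1 : s < 1 := Real.sigmoid_lt_one η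
  have hs : 0 ≤ s * (1 - s) := mul_nonneg hs0.le (sub_nonneg.2 hs1.le)
  have b1 : |-(s * t)| ≤ 1 := by
    rw [abs_neg, abs_mul, abs_of_pos hs0]; nlinarith [abs_nonneg t]
  have b2 : |(1 - s) * t| ≤ 1 := by
    rw [abs_mul, abs_of_pos (sub_pos.2 hs1)]; nlinarith [abs_nonneg t]
  set m := (1 - s) * Real.exp (-(s * t)) + s * Real.exp ((1 - s) * t)
  have h : 1 + s * (1 - s) * t ^ 2 / 4 ≤ m := by
    have e1 := mul_le_mul_of_nonneg_left (one_add_add_sq_div_four_le_exp b1)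
      (sub_nonneg.2 hs1.le)
    have e2 := mul_le_mul_of_nonneg_left (one_add_add_sq_div_four_le_exp b2) hs0.le
    calc _ = (1 - s) * (1 + -(s * t) + (-(s * t)) ^ 2 / 4)
            + s * (1 + (1 - s) * t + ((1 - s) * t) ^ 2 / 4) := by ring
      _ ≤ m := add_le_add e1 e2
  have ht2 : t ^ 2 ≤ 1 := by rw [← sq_abs]; nlinarith [abs_nonneg t]
  have hz0 : 0 ≤ s * (1 - s) * t ^ 2 / 4 := by positivity
  have hz1 : s * (1 - s) * t ^ 2 / 4 ≤ 1 := by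
    nlinarith [mul_le_mul_of_nonneg_left ht2 hs, sq_nonneg (2 * s - 1)]
  have hlog := (half_le_log_one_add hz0 hz1).trans
    (Real.log_le_log (by linarith) h)
  rw [Real.log_mul (Real.exp_pos _).ne' (by linarith), Real.log_exp]
  linarith

/-- A supporting line exists at every point; averaging the one at `z` cancels its slope. -/
lemma convexOn_phi : ConvexOn ℝ Set.univ phi := by
  refine ⟨convex_univ, fun x _ y _ a b ha hb hab => ?_⟩
  simp only [smul_eq_mul]
  set z := a * x + b * y
  have h1 := phi_add_tangent_le z (x - z)
  have h2 := phi_add_tangent_le z (y - z)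
  simp only [add_sub_cancel] at h1 h2
  have e : a * (x - z) + b * (y - z) = 0 := by
    have : a * (x - z) + b * (y - z) = z - (a + b) * z := by simp only [z]; ring
    rw [this, hab]; ring
  have h3 := mul_le_mul_of_nonneg_left h1 ha
  have h4 := mul_le_mul_of_nonneg_left h2 hb
  have e2 : a * (phi z + Real.sigmoid z * (x - z)) + b * (phi z + Real.sigmoid z * (y - z))
      = phi z := by
    linear_combination Real.sigmoid z * e + phi z * hab
  linarith

lemma continuous_phi : Continuous phi := by
  unfold phi
  exact Continuous.log (by fun_prop) fun x => by positivity

lemma hasDerivAt_phi (η : ℝ) : HasDerivAt phi (Real.sigmoid η) η := by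
  have h := ((Real.hasDerivAt_exp η).const_add 1).log (by positivity)
  have e : Real.exp η / (1 + Real.exp η) = Real.sigmoid η := by
    rw [Real.sigmoid_def, Real.exp_neg]
    field_simp
    ring
  exact e ▸ h

lemma exp_neg_phi (η : ℝ) : Real.exp (-phi η) = 1 - Real.sigmoid η := by
  rw [phi, Real.exp_neg, Real.exp_log (by positivity), Real.sigmoid_def, Real.exp_neg]
  field_simp
  ring

lemma exp_sub_phi (η : ℝ) : Real.exp (η - phi η) = Real.sigmoid η := by
  rw [sub_eq_add_neg, Real.exp_add, exp_neg_phi, Real.sigmoid_def, Real.exp_neg]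
  field_simp
  ring

end Scalar

variable {D : Design}

/-! ### Score, information and the law of one observation. -/

section Model

lemma row_nonneg (x : D.Covariates) (a : D.Idx) : 0 ≤ row x a := by
  rcases a with i | ⟨j, k⟩
  · simp [row]
  · simp only [row]; split_ifs <;> norm_num

lemma row_le_one (x : D.Covariates) (a : D.Idx) : row x a ≤ 1 := by
  rcases a with i | ⟨j, k⟩
  · simp [row]
  · simp only [row]; split_ifs <;> norm_num

lemma resp_mem (v : D.Obs) : resp v = 0 ∨ resp v = 1 := by
  rcases v with ⟨y, x⟩
  fin_cases y <;> simp [resp]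

lemma linPred_add (b c : D.Params) (x : D.Covariates) :
    linPred (b + c) x = linPred b x + linPred c x := by
  simp [linPred, mul_add, Finset.sum_add_distrib]

lemma linPred_smul (t : ℝ) (b : D.Params) (x : D.Covariates) :
    linPred (t • b) x = t * linPred b x := by
  simp only [linPred, PiLp.smul_apply, smul_eq_mul, Finset.mul_sum]
  exact Finset.sum_congr rfl fun a _ => by ring

lemma continuous_linPred (x : D.Covariates) : Continuous fun b : D.Params => linPred b x := by
  unfold linPred
  fun_prop

lemma log_density (b : D.Params) (v : D.Obs) :
    Real.log (density b v) = resp v * linPred b v.2 - phi (linPred b v.2) := by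
  rw [density, Real.log_exp]

lemma hasFDerivAt_linPred (x : D.Covariates) (b : D.Params) :
    HasFDerivAt (fun b : D.Params => linPred b x)
      (∑ a, row x a • (EuclideanSpace.proj a : D.Params →L[ℝ] ℝ)) b := by
  have h := (∑ a, row x a • (EuclideanSpace.proj a : D.Params →L[ℝ] ℝ)).hasFDerivAt (x := b)
  convert h using 1
  ext b
  simp [linPred]

lemma score_eq (b : D.Params) (v : D.Obs) (a : D.Idx) :
    score b v a = (resp v - Real.sigmoid (linPred b v.2)) * row v.2 a := by
  have h1 := hasFDerivAt_linPred v.2 b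
  have h2 := (hasDerivAt_phi (linPred b v.2)).comp_hasFDerivAt b h1
  have h3 := (h1.const_mul (resp v)).sub h2
  have h4 : HasFDerivAt (fun b : D.Params => Real.log (density b v)) _ b :=
    h3.congr_of_eventuallyEq (Eventually.of_forall fun c => log_density c v)
  have h5 : (∑ c, row v.2 c • (EuclideanSpace.proj c : D.Params →L[ℝ] ℝ))
      (EuclideanSpace.single a 1) = row v.2 a := by
    simp only [sum_apply, smul_apply,
      PiLp.proj_apply, PiLp.single_apply, smul_eq_mul, mul_ite, mul_one, mul_zero,
      Finset.sum_ite_eq', Finset.mem_univ, if_true]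
  rw [score, h4.fderiv, sub_mul, sub_apply, smul_apply,
    smul_apply, h5, smul_eq_mul, smul_eq_mul]

lemma density_zero (b : D.Params) (x : D.Covariates) :
    density b (0, x) = 1 - Real.sigmoid (linPred b x) := by
  simp [density, resp, exp_neg_phi]

lemma density_one (b : D.Params) (x : D.Covariates) :
    density b (1, x) = Real.sigmoid (linPred b x) := by
  simp [density, resp, exp_sub_phi]

/-- The contribution of one observation to the observed information matrix. -/
def information (b : D.Params) (v : D.Obs) (q : D.Idx × D.Idx) : ℝ :=
  Real.sigmoid (linPred b v.2) * (1 - Real.sigmoid (linPred b v.2)) * row v.2 q.1 * row v.2 q.2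

lemma abs_score_le_one (b : D.Params) (v : D.Obs) (a : D.Idx) : |score b v a| ≤ 1 := by
  rw [score_eq, abs_mul, abs_of_nonneg (row_nonneg _ _)]
  have h : |resp v - Real.sigmoid (linPred b v.2)| ≤ 1 := by
    have := Real.sigmoid_nonneg (linPred b v.2)
    have := Real.sigmoid_le_one (linPred b v.2)
    rw [abs_le]
    rcases resp_mem v with h | h <;> rw [h] <;> constructor <;> linarith
  exact mul_le_one₀ h (row_nonneg _ _) (row_le_one _ _)

lemma abs_information_le_one (b : D.Params) (v : D.Obs) (q : D.Idx × D.Idx) : |information b v q| ≤ 1 := by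
  have h0 := Real.sigmoid_nonneg (linPred b v.2)
  have h1 := Real.sigmoid_le_one (linPred b v.2)
  have r1 := row_nonneg v.2 q.1
  have r2 := row_nonneg v.2 q.2
  have h2 : 0 ≤ 1 - Real.sigmoid (linPred b v.2) := by linarith
  rw [information, abs_of_nonneg (by positivity)]
  refine mul_le_one₀ (mul_le_one₀ (mul_le_one₀ h1 h2 (by linarith)) r1 (row_le_one _ _)) r2
    (row_le_one _ _)

variable (μ : Measure D.Covariates) [IsProbabilityMeasure μ] (b : D.Params)

instance : IsFiniteMeasure (obsLaw μ b) :=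
  isFiniteMeasure_withDensity_ofReal (Integrable.of_finite).2

lemma integral_obsLaw (g : D.Obs → ℝ) :
    ∫ v, g v ∂(obsLaw μ b) =
      ∫ x, ((1 - Real.sigmoid (linPred b x)) * g (0, x)
        + Real.sigmoid (linPred b x) * g (1, x)) ∂μ := by
  rw [obsLaw, integral_withDensity_eq_integral_toReal_smul (by fun_prop) (by simp),
    integral_prod _ Integrable.of_finite]
  rw [integral_fintype Integrable.of_finite]
  simp only [Fin.sum_univ_two, measureReal_def, Measure.count_singleton, ENNReal.toReal_one,
    one_smul, density_zero, density_one]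
  rw [← integral_add Integrable.of_finite Integrable.of_finite]
  refine integral_congr_ae (Eventually.of_forall fun x => ?_)
  simp only [smul_eq_mul]
  rw [ENNReal.toReal_ofReal (Real.sigmoid_nonneg _),
    ENNReal.toReal_ofReal (sub_nonneg.2 (Real.sigmoid_le_one _))]

instance : IsProbabilityMeasure (obsLaw μ b) := by
  constructor
  have h := integral_obsLaw μ b (fun _ => 1)
  simp only [mul_one, sub_add_cancel] at h
  simp only [integral_const, smul_eq_mul, mul_one, probReal_univ] at h
  rw [measureReal_def] at h
  rwa [ENNReal.toReal_eq_one_iff] at h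

instance (n : ℕ) : IsProbabilityMeasure (sampleLaw μ b n) := by
  unfold sampleLaw; infer_instance

lemma integral_score (a : D.Idx) : ∫ v, score b v a ∂(obsLaw μ b) = 0 := by
  rw [integral_obsLaw, ← integral_zero D.Covariates ℝ (μ := μ)]
  congr 1
  ext x
  simp only [score_eq, resp]
  simp
  ring

/-- The information equality: given `x`, the squared residual of the response has mean `s(1-s)` with
`s = sigmoid (x β)`. -/
lemma integral_information (q : D.Idx × D.Idx) :
    ∫ v, information b v q ∂(obsLaw μ b) = fisherInfo μ b q.1 q.2 := by
  rw [fisherInfo, Matrix.of_apply, integral_obsLaw, integral_obsLaw]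
  congr 1
  ext x
  simp only [score_eq, resp, information]
  simp
  ring

end Model

/-! ### A Chebyshev bound for vectors of empirical sums. -/

section Chebyshev

open ProbabilityTheory in
-- Markov's inequality for the squared Euclidean deviation: each coordinate is a sum of `n`
-- independent terms of variance at most `1`.
lemma measure_sum_sq_deviation_le {Ω A : Type*} [MeasurableSpace Ω] [Finite Ω]
    [DiscreteMeasurableSpace Ω] [Fintype A] (P : Measure Ω) [IsProbabilityMeasure P]
    (n : ℕ) (g : Ω → A → ℝ) (hg : ∀ ω a, |g ω a| ≤ 1) {t : ℝ} (ht : 0 < t) :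
    Measure.pi (fun _ : Fin n => P)
        {d | t ≤ ∑ a, (∑ i, g (d i) a - n * ∫ ω, g ω a ∂P) ^ 2} ≤
      ENNReal.ofReal (Fintype.card A * n / t) := by
  set Q := Measure.pi (fun _ : Fin n => P)
  have hvar (a : A) : ∫ d, (∑ i, g (d i) a - n * ∫ ω, g ω a ∂P) ^ 2 ∂Q ≤ n := by
    have hL (i : Fin n) : MemLp (fun ω => g ω a) 2 P := .of_bound
      Measurable.of_discrete.aestronglyMeasurable 1 (Eventually.of_forall fun ω => hg ω a)
    have h := variance_sum_pi (μ := fun _ : Fin n => P) (X := fun _ ω => g ω a) hL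
    have hmean : ∫ d, ∑ i, g (d i) a ∂Q = n * ∫ ω, g ω a ∂P := by
      rw [integral_finsetSum _ fun i _ => Integrable.of_finite]
      have (i : Fin n) : ∫ d, g (d i) a ∂Q = ∫ ω, g ω a ∂P :=
        integral_comp_eval (μ := fun _ : Fin n => P)
          (Measurable.of_discrete (f := fun ω => g ω a)).aestronglyMeasurable
      simp [this]
    have hv1 : Var[fun ω => g ω a; P] ≤ 1 := by
      refine (variance_le_expectation_sq
        (Measurable.of_discrete (f := fun ω => g ω a)).aestronglyMeasurable).trans ?_
      calc _ ≤ ∫ _, (1 : ℝ) ∂P := integral_mono Integrable.of_finite Integrable.of_finite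
            fun ω => by
              have := hg ω a
              simp only [Pi.pow_apply]
              rw [← sq_abs]
              nlinarith [abs_nonneg (g ω a)]
        _ = 1 := by simp
    rw [variance_eq_integral Measurable.of_discrete.aemeasurable] at h
    simp only [Finset.sum_apply] at h
    rw [hmean] at h
    rw [h]
    calc _ ≤ ∑ _i : Fin n, (1 : ℝ) := Finset.sum_le_sum fun i _ => hv1
      _ = n := by simp
  have hm := mul_meas_ge_le_integral_of_nonneg (μ := Q)
    (f := fun d => ∑ a, (∑ i, g (d i) a - n * ∫ ω, g ω a ∂P) ^ 2)
    (Eventually.of_forall fun d => Finset.sum_nonneg fun a _ => sq_nonneg _)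
    Integrable.of_finite t
  rw [integral_finsetSum _ fun i _ => Integrable.of_finite] at hm
  have hs := Finset.sum_le_sum fun a (_ : a ∈ Finset.univ) => hvar a
  simp only [Finset.sum_const, Finset.card_univ, nsmul_eq_mul] at hs
  rw [← ofReal_measureReal]
  apply ENNReal.ofReal_le_ofReal
  rw [le_div_iff₀ ht, mul_comm]
  exact hm.trans hs

end Chebyshev

/-! ### From a sphere to global minimizers. -/

section Minimizers

variable {E : Type*} [NormedAddCommGroup E] [NormedSpace ℝ E]

/-- The segment from `b` to `c` crosses the sphere at a fraction `t < 1`, so convexity makes the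
increase up to `c` at least `1/t` times the one at the crossing. -/
lemma ConvexOn.lt_outside_ball {G : E → ℝ} (hG : ConvexOn ℝ Set.univ G) {b : E} {r h : ℝ}
    (hr : 0 < r) (hh : 0 ≤ h) (hs : ∀ u : E, ‖u‖ = r → G b + h < G (b + u)) {c : E}
    (hc : r < ‖c - b‖) : G b + h < G c := by
  have h0 : 0 < ‖c - b‖ := hr.trans hc
  set t := r / ‖c - b‖
  have ht0 : 0 < t := div_pos hr h0
  have ht1 : t < 1 := (div_lt_one h0).2 hc
  have hn : ‖t • (c - b)‖ = r := by
    rw [norm_smul, Real.norm_eq_abs, abs_of_pos ht0]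
    exact div_mul_cancel₀ r h0.ne'
  have h1 := hs _ hn
  have h2 := hG.2 (Set.mem_univ b) (Set.mem_univ c) (sub_nonneg.2 ht1.le) ht0.le (by ring)
  have e : (1 - t) • b + t • c = b + t • (c - b) := by module
  rw [e, smul_eq_mul, smul_eq_mul] at h2
  have h3 : h < t * (G c - G b) := by linarith
  have h4 : 0 < G c - G b := pos_of_mul_pos_right (hh.trans_lt h3) ht0.le
  nlinarith

/-- As `P` is not convex, the margin on the sphere must cover all of `P b`; then `P ≥ 0` is enough
outside the ball. -/
lemma exists_isMinOn_of_sphere [ProperSpace E] {G P : E → ℝ} (hG : ConvexOn ℝ Set.univ G)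
    (hP : ∀ x, 0 ≤ P x) (hlsc : LowerSemicontinuous fun x => G x + P x) {b : E} {r : ℝ}
    (hr : 0 < r) (hs : ∀ u : E, ‖u‖ = r → G b + P b < G (b + u)) :
    (∃ m, ∀ x, G m + P m ≤ G x + P x) ∧
      ∀ m, (∀ x, G m + P m ≤ G x + P x) → ‖m - b‖ ≤ r := by
  have hout {c : E} (hc : r < ‖c - b‖) : G b + P b < G c + P c := by
    have := ConvexOn.lt_outside_ball hG hr (hP b) hs hc
    linarith [hP c]
  refine ⟨?_, fun m hm => not_lt.1 fun h => (hout h).not_ge (hm b)⟩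
  obtain ⟨m, -, hm⟩ := LowerSemicontinuousOn.exists_isMinOn
    (Metric.nonempty_closedBall.2 hr.le) (isCompact_closedBall b r) (hlsc.lowerSemicontinuousOn _)
  rw [isMinOn_iff] at hm
  refine ⟨m, fun x => ?_⟩
  by_cases hx : ‖x - b‖ ≤ r
  · exact hm x (by rwa [Metric.mem_closedBall, dist_eq_norm])
  · exact (hm b (Metric.mem_closedBall_self hr.le)).trans (hout (not_le.1 hx)).le

end Minimizers

/-! ### Block norms. -/

section GroupNorm

lemma groupNorm_eq_norm (b : D.Params) (j : Fin D.J) :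
    groupNorm b j =
      ‖(WithLp.toLp 2 fun k => b (Sum.inr ⟨j, k⟩) : EuclideanSpace ℝ (Fin (D.p j)))‖ := by
  rw [EuclideanSpace.norm_eq, groupNorm]
  simp

lemma groupNorm_nonneg (b : D.Params) (j : Fin D.J) : 0 ≤ groupNorm b j := Real.sqrt_nonneg _

lemma groupNorm_add_le (b c : D.Params) (j : Fin D.J) :
    groupNorm (b + c) j ≤ groupNorm b j + groupNorm c j := by
  simp only [groupNorm_eq_norm]
  exact norm_add_le (WithLp.toLp 2 fun k => b (Sum.inr ⟨j, k⟩) : EuclideanSpace ℝ (Fin (D.p j)))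
    (WithLp.toLp 2 fun k => c (Sum.inr ⟨j, k⟩))

lemma groupNorm_smul (t : ℝ) (b : D.Params) (j : Fin D.J) :
    groupNorm (t • b) j = |t| * groupNorm b j := by
  simp only [groupNorm_eq_norm]
  rw [← Real.norm_eq_abs, ← norm_smul]
  rfl

lemma groupNorm_neg (b : D.Params) (j : Fin D.J) : groupNorm (-b) j = groupNorm b j := by
  simpa using groupNorm_smul (-1) b j

lemma groupNorm_le_norm (b : D.Params) (j : Fin D.J) : groupNorm b j ≤ ‖b‖ := by
  rw [groupNorm]
  refine Real.sqrt_le_iff.2 ⟨norm_nonneg b, ?_⟩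
  rw [EuclideanSpace.real_norm_sq_eq, Fintype.sum_sum_type, Fintype.sum_sigma]
  have h1 := Finset.single_le_sum
    (f := fun j : Fin D.J => ∑ k : Fin (D.p j), b (Sum.inr ⟨j, k⟩) ^ 2)
    (fun i _ => Finset.sum_nonneg fun k _ => sq_nonneg _) (Finset.mem_univ j)
  have h2 : 0 ≤ ∑ i, b (Sum.inl i) ^ 2 := Finset.sum_nonneg fun k _ => sq_nonneg _
  linarith

lemma continuous_groupNorm (j : Fin D.J) : Continuous fun b : D.Params => groupNorm b j := by
  unfold groupNorm
  fun_prop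

lemma convexOn_groupNorm (j : Fin D.J) :
    ConvexOn ℝ Set.univ fun b : D.Params => groupNorm b j := by
  refine ⟨convex_univ, fun x _ y _ s t hs ht _ => ?_⟩
  have h := groupNorm_add_le (s • x) (t • y) j
  rwa [groupNorm_smul, groupNorm_smul, abs_of_nonneg hs, abs_of_nonneg ht] at h

end GroupNorm

/-! ### Convex and fusion parts of the objective. -/

section Objective

/-- The convex part of the objective function: negative log likelihood and group lasso penalty. -/
def convexPart {n : ℕ} (T : Tuning D) (d : D.Sample n) (b : D.Params) : ℝ :=
  -logLik d b + T.lam1 * ∑ j, T.w1 j * groupNorm b j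

/-- The `L₀`-fusion part of the penalty. -/
def fusionPart (T : Tuning D) (b : D.Params) : ℝ :=
  T.lam0 * ∑ j, ∑ r : Fin (D.p j + 1), ∑ s ∈ Finset.Ioi r,
    T.w0 j r s * l0 (coef b j r - coef b j s)

lemma objective_eq {n : ℕ} (T : Tuning D) (d : D.Sample n) (b : D.Params) :
    objective T d b = convexPart T d b + fusionPart T b := by
  simp only [objective, penalty, convexPart, fusionPart, add_assoc]

lemma neg_logLik_eq {n : ℕ} (d : D.Sample n) (b : D.Params) :
    -logLik d b = ∑ i, (phi (linPred b (d i).2) - resp (d i) * linPred b (d i).2) := by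
  simp only [logLik, log_density, ← Finset.sum_neg_distrib, neg_sub]

lemma convexOn_neg_logLik {n : ℕ} (d : D.Sample n) :
    ConvexOn ℝ Set.univ fun b : D.Params => -logLik d b := by
  simp only [neg_logLik_eq]
  refine ⟨convex_univ, fun x _ y _ s t hs ht hst => ?_⟩
  simp only [smul_eq_mul, Finset.mul_sum, ← Finset.sum_add_distrib, linPred_add, linPred_smul]
  refine Finset.sum_le_sum fun i _ => ?_
  have h := convexOn_phi.2 (Set.mem_univ (linPred x (d i).2)) (Set.mem_univ (linPred y (d i).2))
    hs ht hst
  simp only [smul_eq_mul] at h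
  linarith

lemma convexOn_convexPart {n : ℕ} (T : Tuning D) (d : D.Sample n) :
    ConvexOn ℝ Set.univ (convexPart T d) := by
  refine (convexOn_neg_logLik d).add ?_
  refine ⟨convex_univ, fun x _ y _ s t hs ht hst => ?_⟩
  simp only [smul_eq_mul, Finset.mul_sum, ← Finset.sum_add_distrib]
  refine Finset.sum_le_sum fun j _ => ?_
  have h := (convexOn_groupNorm j).2 (Set.mem_univ x) (Set.mem_univ y) hs ht hst
  simp only [smul_eq_mul] at h
  have h' := mul_le_mul_of_nonneg_left h (mul_nonneg T.lam1_nonneg (T.w1_nonneg j))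
  linarith

lemma continuous_convexPart {n : ℕ} (T : Tuning D) (d : D.Sample n) :
    Continuous (convexPart T d) := by
  unfold convexPart
  simp only [neg_logLik_eq]
  refine .add ?_ (continuous_const.mul
    (continuous_finsetSum _ fun j _ => continuous_const.mul (continuous_groupNorm j)))
  exact continuous_finsetSum _ fun i _ => (continuous_phi.comp (continuous_linPred _)).sub
    (continuous_const.mul (continuous_linPred _))

lemma l0_nonneg (t : ℝ) : 0 ≤ l0 t := by
  unfold l0; split_ifs <;> norm_num

lemma l0_le_one (t : ℝ) : l0 t ≤ 1 := by
  unfold l0; split_ifs <;> norm_num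

lemma fusionPart_nonneg (T : Tuning D) (b : D.Params) : 0 ≤ fusionPart T b :=
  mul_nonneg T.lam0_nonneg <| Finset.sum_nonneg fun j _ => Finset.sum_nonneg fun r _ =>
    Finset.sum_nonneg fun s hs => mul_nonneg (T.w0_nonneg j r s (Finset.mem_Ioi.1 hs)) (l0_nonneg _)

lemma continuous_coef (j : Fin D.J) (r : Fin (D.p j + 1)) :
    Continuous fun b : D.Params => coef b j r := by
  unfold coef
  refine Fin.cases ?_ (fun k => ?_) r
  · simpa using continuous_const
  · simp only [Fin.cases_succ]; fun_prop

/-- A nonnegative multiple of the indicator of an open set. -/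
lemma lowerSemicontinuous_mul_l0 {c : ℝ} (hc : 0 ≤ c) :
    LowerSemicontinuous fun t : ℝ => c * l0 t := by
  have h : (fun t : ℝ => c * l0 t) = Set.indicator ({0}ᶜ : Set ℝ) fun _ => c := by
    ext t
    by_cases ht : t = 0 <;> simp [l0, ht]
  rw [h]
  exact isOpen_compl_singleton.lowerSemicontinuous_indicator hc

lemma lowerSemicontinuous_fusionPart (T : Tuning D) : LowerSemicontinuous (fusionPart T) := by
  unfold fusionPart
  simp only [Finset.mul_sum, ← mul_assoc]
  exact lowerSemicontinuous_sum fun j _ => lowerSemicontinuous_sum fun r _ =>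
    lowerSemicontinuous_sum fun s hs =>
      LowerSemicontinuous.comp (f := fun t => T.lam0 * T.w0 j r s * l0 t)
        (lowerSemicontinuous_mul_l0 (mul_nonneg T.lam0_nonneg
          (T.w0_nonneg j r s (Finset.mem_Ioi.1 hs))))
        ((continuous_coef j r).sub (continuous_coef j s))

lemma a1_nonneg (T : Tuning D) : 0 ≤ a1 T :=
  Real.iSup_nonneg fun j => mul_nonneg T.lam1_nonneg (T.w1_nonneg j)

lemma a0_nonneg (T : Tuning D) : 0 ≤ a0 T :=
  Real.iSup_nonneg fun q => mul_nonneg T.lam0_nonneg (T.w0_nonneg _ _ _ q.2)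

lemma le_a1 (T : Tuning D) (j : Fin D.J) : T.lam1 * T.w1 j ≤ a1 T :=
  le_ciSup (f := fun j => T.lam1 * T.w1 j) (Set.finite_range _).bddAbove j

lemma le_a0 (T : Tuning D) {j : Fin D.J} {r s : Fin (D.p j + 1)} (h : r < s) :
    T.lam0 * T.w0 j r s ≤ a0 T :=
  le_ciSup (f := fun q : {q : Σ j : Fin D.J, Fin (D.p j + 1) × Fin (D.p j + 1) // q.2.1 < q.2.2} =>
    T.lam0 * T.w0 q.1.1 q.1.2.1 q.1.2.2) (Set.finite_range _).bddAbove ⟨⟨j, r, s⟩, h⟩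

/-- A crude count of pairs suffices: factor `j` has at most `(p j + 1) * p j ≤ (p + 1) * p j` of
them. -/
lemma fusionPart_le (T : Tuning D) (b : D.Params) :
    fusionPart T b ≤ a0 T * ((D.numLevels : ℝ) ^ 2 + D.numLevels) := by
  have h0 := a0_nonneg T
  have hp (j : Fin D.J) : D.p j ≤ D.numLevels :=
    Finset.single_le_sum (f := D.p) (fun _ _ => Nat.zero_le _) (Finset.mem_univ j)
  unfold fusionPart
  simp only [Finset.mul_sum, ← mul_assoc]
  calc _ ≤ ∑ j, ∑ r : Fin (D.p j + 1), ∑ s ∈ Finset.Ioi r, a0 T := by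
        refine Finset.sum_le_sum fun j _ => Finset.sum_le_sum fun r _ =>
          Finset.sum_le_sum fun s hs => ?_
        have hs' := Finset.mem_Ioi.1 hs
        exact (mul_le_of_le_one_right (mul_nonneg T.lam0_nonneg (T.w0_nonneg j r s hs'))
          (l0_le_one _)).trans (le_a0 T hs')
    _ ≤ ∑ j, ∑ r : Fin (D.p j + 1), (D.p j : ℝ) * a0 T := by
        refine Finset.sum_le_sum fun j _ => Finset.sum_le_sum fun r _ => ?_
        rw [Finset.sum_const, nsmul_eq_mul, Fin.card_Ioi]
        refine mul_le_mul_of_nonneg_right ?_ h0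
        exact_mod_cast (by omega : D.p j + 1 - 1 - r ≤ D.p j)
    _ = ∑ j, (D.p j : ℝ) * ((D.p j + 1) * a0 T) := by
        refine Finset.sum_congr rfl fun j _ => ?_
        simp
        ring
    _ ≤ ∑ j, (D.p j : ℝ) * ((D.numLevels + 1) * a0 T) := by
        refine Finset.sum_le_sum fun j _ => ?_
        have : (D.p j : ℝ) ≤ D.numLevels := by exact_mod_cast hp j
        gcongr
    _ = a0 T * ((D.numLevels : ℝ) ^ 2 + D.numLevels) := by
        rw [← Finset.sum_mul]
        have : ∑ j, (D.p j : ℝ) = D.numLevels := by simp [Design.numLevels]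
        rw [this]
        ring

lemma group_penalty_le (T : Tuning D) (b u : D.Params) :
    T.lam1 * ∑ j, T.w1 j * groupNorm b j ≤
      T.lam1 * ∑ j, T.w1 j * groupNorm (b + u) j + a1 T * D.J * ‖u‖ := by
  have h (j : Fin D.J) : T.lam1 * (T.w1 j * groupNorm b j) ≤
      T.lam1 * (T.w1 j * groupNorm (b + u) j) + a1 T * ‖u‖ := by
    have h1 : groupNorm b j ≤ groupNorm (b + u) j + groupNorm u j := by
      have := groupNorm_add_le (b + u) (-u) j
      rwa [add_neg_cancel_right, groupNorm_neg] at this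
    have h2 := mul_nonneg T.lam1_nonneg (T.w1_nonneg j)
    have h3 := mul_le_mul (le_a1 T j) (groupNorm_le_norm u j) (groupNorm_nonneg u j) (a1_nonneg T)
    have h4 := mul_le_mul_of_nonneg_left h1 h2
    linarith
  have hs := Finset.sum_le_sum fun j (_ : j ∈ Finset.univ) => h j
  rw [Finset.sum_add_distrib, ← Finset.mul_sum, ← Finset.mul_sum] at hs
  simp only [Finset.sum_const, Finset.card_univ, Fintype.card_fin, nsmul_eq_mul] at hs
  linarith

end Objective

/-! ### Quadratic lower bound for the objective on a sphere. -/

section Expansion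

lemma sum_mul_score (b u : D.Params) (v : D.Obs) :
    ∑ a, u a * score b v a = (resp v - Real.sigmoid (linPred b v.2)) * linPred u v.2 := by
  simp only [score_eq, linPred, Finset.mul_sum]
  exact Finset.sum_congr rfl fun a _ => by ring

lemma sum_mul_information (b u : D.Params) (v : D.Obs) :
    ∑ q : D.Idx × D.Idx, u q.1 * u q.2 * information b v q =
      Real.sigmoid (linPred b v.2) * (1 - Real.sigmoid (linPred b v.2)) * linPred u v.2 ^ 2 := by
  have h : linPred u v.2 ^ 2 = ∑ a, ∑ c, row v.2 a * u a * (row v.2 c * u c) := by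
    rw [sq, linPred, Finset.sum_mul_sum]
  rw [h, Fintype.sum_prod_type]
  simp only [Finset.mul_sum]
  exact Finset.sum_congr rfl fun a _ => Finset.sum_congr rfl fun c _ => by
    rw [information]; ring

lemma neg_logLik_add_ge {n : ℕ} (d : D.Sample n) (b u : D.Params)
    (hu : ∀ x, |linPred u x| ≤ 1) :
    -logLik d b - ∑ a, u a * ∑ i, score b (d i) a
        + (∑ q : D.Idx × D.Idx, u q.1 * u q.2 * ∑ i, information b (d i) q) / 8 ≤
      -logLik d (b + u) := by
  have e1 : ∑ a, u a * ∑ i, score b (d i) a = ∑ i, ∑ a, u a * score b (d i) a := by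
    simp only [Finset.mul_sum]
    exact Finset.sum_comm
  have e2 : ∑ q : D.Idx × D.Idx, u q.1 * u q.2 * ∑ i, information b (d i) q =
      ∑ i, ∑ q : D.Idx × D.Idx, u q.1 * u q.2 * information b (d i) q := by
    simp only [Finset.mul_sum]
    exact Finset.sum_comm
  rw [e1, e2, neg_logLik_eq, neg_logLik_eq, Finset.sum_div, ← Finset.sum_sub_distrib,
    ← Finset.sum_add_distrib]
  refine Finset.sum_le_sum fun i _ => ?_
  rw [sum_mul_score, sum_mul_information, linPred_add]
  have := phi_add_quadratic_le (linPred b (d i).2) (hu (d i).2)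
  linarith

lemma abs_linPred_le (u : D.Params) (x : D.Covariates) :
    |linPred u x| ≤ Real.sqrt (Fintype.card D.Idx) * ‖u‖ := by
  refine abs_le_of_sq_le_sq ?_ (by positivity)
  rw [mul_pow, Real.sq_sqrt (by positivity), EuclideanSpace.real_norm_sq_eq]
  refine (Finset.sum_mul_sq_le_sq_mul_sq _ _ _).trans ?_
  refine mul_le_mul_of_nonneg_right ?_ (Finset.sum_nonneg fun _ _ => sq_nonneg _)
  calc ∑ a, row x a ^ 2 ≤ ∑ _a : D.Idx, (1 : ℝ) := Finset.sum_le_sum fun a _ =>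
        pow_le_one₀ (row_nonneg x a) (row_le_one x a)
    _ = Fintype.card D.Idx := by simp

lemma abs_sum_mul_le_of_sum_sq_le {A : Type*} [Fintype A] {f g : A → ℝ} {s t : ℝ} (hs : 0 ≤ s)
    (ht : 0 ≤ t) (hf : ∑ a, f a ^ 2 ≤ s ^ 2) (hg : ∑ a, g a ^ 2 ≤ t ^ 2) :
    |∑ a, f a * g a| ≤ s * t := by
  refine abs_le_of_sq_le_sq ?_ (mul_nonneg hs ht)
  rw [mul_pow]
  exact (Finset.sum_mul_sq_le_sq_mul_sq _ _ _).trans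
    (mul_le_mul hf hg (Finset.sum_nonneg fun _ _ => sq_nonneg _) (sq_nonneg s))

/-- The observed information form is at least `nκr² - nκr²/2`; an eighth of it gives the `nκr²/16`
in `hbig`, from which score and group lasso subtract multiples of `r`. -/
lemma convexPart_lt_of_norm_eq {n : ℕ} (T : Tuning D) (d : D.Sample n) (b : D.Params)
    (I : Matrix D.Idx D.Idx ℝ) {κ s r : ℝ} (hκ : 0 ≤ κ) (hs : 0 ≤ s)
    (hI : ∀ u : D.Params, κ * ‖u‖ ^ 2 ≤ ∑ a, ∑ c, u a * I a c * u c)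
    (hscore : ∑ a, (∑ i, score b (d i) a) ^ 2 ≤ s ^ 2)
    (hinfo : ∑ q : D.Idx × D.Idx, (∑ i, information b (d i) q - n * I q.1 q.2) ^ 2 ≤
      (n * κ / 2) ^ 2)
    (hsmall : Real.sqrt (Fintype.card D.Idx) * r ≤ 1)
    (hbig : fusionPart T b < n * κ * r ^ 2 / 16 - s * r - a1 T * D.J * r)
    {u : D.Params} (hu : ‖u‖ = r) :
    convexPart T d b + fusionPart T b < convexPart T d (b + u) := by
  have hr : 0 ≤ r := hu ▸ norm_nonneg u
  have hu2 : ∑ a, u a ^ 2 = r ^ 2 := by rw [← hu, EuclideanSpace.real_norm_sq_eq]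
  have h1 := neg_logLik_add_ge d b u fun x => (abs_linPred_le u x).trans (hu ▸ hsmall)
  have h2 := (abs_le.1 (abs_sum_mul_le_of_sum_sq_le hr hs hu2.le hscore)).2
  have huu : ∑ q : D.Idx × D.Idx, (u q.1 * u q.2) ^ 2 ≤ (r ^ 2) ^ 2 := by
    rw [sq (r ^ 2), ← hu2, Finset.sum_mul_sum, Fintype.sum_prod_type]
    simp only [mul_pow, le_refl]
  -- Cauchy–Schwarz over pairs of indices: the Frobenius norm controls the quadratic form.
  have h3 := (abs_le.1 (abs_sum_mul_le_of_sum_sq_le (sq_nonneg r) (by positivity) huu hinfo)).1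
  have h4 : ∑ q : D.Idx × D.Idx, u q.1 * u q.2 * (∑ i, information b (d i) q - n * I q.1 q.2) =
      ∑ q : D.Idx × D.Idx, u q.1 * u q.2 * ∑ i, information b (d i) q
        - n * ∑ a, ∑ c, u a * I a c * u c := by
    simp only [mul_sub, Finset.sum_sub_distrib]
    congr 1
    rw [Fintype.sum_prod_type]
    simp only [Finset.mul_sum]
    exact Finset.sum_congr rfl fun a _ => Finset.sum_congr rfl fun c _ => by ring
  rw [h4] at h3
  have h5 := mul_le_mul_of_nonneg_left (hI u) (Nat.cast_nonneg n)
  rw [hu] at h5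
  have h6 := group_penalty_le T b u
  rw [hu] at h6
  unfold convexPart
  linarith

/-- A sample whose score is small and whose observed information is close to the expected one has an
estimate, and all its estimates are close to the parameter. -/
lemma argmins_of_score_of_information {n : ℕ} (T : Tuning D) (d : D.Sample n) (b : D.Params)
    (I : Matrix D.Idx D.Idx ℝ) {κ s r : ℝ} (hκ : 0 ≤ κ) (hs : 0 ≤ s)
    (hI : ∀ u : D.Params, κ * ‖u‖ ^ 2 ≤ ∑ a, ∑ c, u a * I a c * u c)
    (hscore : ∑ a, (∑ i, score b (d i) a) ^ 2 ≤ s ^ 2)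
    (hinfo : ∑ q : D.Idx × D.Idx, (∑ i, information b (d i) q - n * I q.1 q.2) ^ 2 ≤
      (n * κ / 2) ^ 2)
    (hr : 0 < r) (hsmall : Real.sqrt (Fintype.card D.Idx) * r ≤ 1)
    (hbig : fusionPart T b < n * κ * r ^ 2 / 16 - s * r - a1 T * D.J * r) :
    (argmins T d).Nonempty ∧ ∀ m ∈ argmins T d, ‖m - b‖ ≤ r := by
  have h := exists_isMinOn_of_sphere (convexOn_convexPart T d) (fusionPart_nonneg T)
    ((continuous_convexPart T d).lowerSemicontinuous.add (lowerSemicontinuous_fusionPart T)) hr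
    fun u hu => convexPart_lt_of_norm_eq T d b I hκ hs hI hscore hinfo hsmall hbig hu
  simpa only [argmins, Set.Nonempty, Set.mem_ofPred_eq, objective_eq] using h

end Expansion

/-! ### Probability bounds for score and information. -/

section Stochastic

lemma card_idx_le (hD : 1 ≤ D.numLevels) : Fintype.card D.Idx ≤ 2 * D.numLevels := by
  have h : Fintype.card D.Idx = D.intercept.toNat + D.numLevels := by
    simp [Design.Idx, Design.numLevels]
  have := Bool.toNat_le D.intercept
  omega

variable (μ : Measure D.Covariates) [IsProbabilityMeasure μ] (b : D.Params)

lemma sampleLaw_score_ge_le (n : ℕ) {t : ℝ} (ht : 0 < t) :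
    sampleLaw μ b n {d | t ≤ ∑ a, (∑ i, score b (d i) a) ^ 2} ≤
      ENNReal.ofReal (Fintype.card D.Idx * n / t) := by
  have h := measure_sum_sq_deviation_le (obsLaw μ b) n (fun v a => score b v a)
    (abs_score_le_one b) ht
  simpa only [sampleLaw, integral_score, mul_zero, sub_zero] using h

lemma sampleLaw_information_ge_le (n : ℕ) {t : ℝ} (ht : 0 < t) :
    sampleLaw μ b n {d | t ≤ ∑ q : D.Idx × D.Idx,
        (∑ i, information b (d i) q - n * fisherInfo μ b q.1 q.2) ^ 2} ≤
      ENNReal.ofReal ((Fintype.card D.Idx : ℝ) ^ 2 * n / t) := by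
  have h := measure_sum_sq_deviation_le (obsLaw μ b) n (information b)
    (abs_information_le_one b) ht
  simpa only [sampleLaw, integral_information, Fintype.card_prod, Nat.cast_pow, ← sq] using h

end Stochastic

/-! ### The rate: constants and exceptional events. -/

lemma tendsto_sq_div_of_pow_four {p : ℕ → ℕ}
    (hp : Tendsto (fun n : ℕ => (p n : ℝ) ^ 4 / n) atTop (𝓝 0)) :
    Tendsto (fun n : ℕ => (p n : ℝ) ^ 2 / n) atTop (𝓝 0) := by
  refine squeeze_zero (fun n => by positivity) (fun n => ?_) hp
  refine div_le_div_of_nonneg_right ?_ (Nat.cast_nonneg n)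
  rcases Nat.eq_zero_or_pos (p n) with h | h
  · simp [h]
  · exact pow_le_pow_right₀ (by exact_mod_cast h) (by norm_num)

/-- For `p ≤ 1` the factor `p(p-1)` vanishes, so the variable is at distance exactly `c > 0` from
its limit with probability one. The bound `p ≥ 2` later allows comparing `p² + p` with `p(p-1)`. -/
lemma eventually_two_le_numLevels {D : ℕ → Design} {Ω : ℕ → Type*} [∀ n, MeasurableSpace (Ω n)]
    (P : ∀ n, Measure (Ω n)) [∀ n, IsProbabilityMeasure (P n)] {A : ∀ n, Ω n → ℝ} {c : ℝ}
    (hc : 0 < c)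
    (h : TendstoInProb P
      (fun n d => A n d * ((D n).numLevels * ((D n).numLevels - 1 : ℝ))) c) :
    ∀ᶠ n in atTop, 2 ≤ (D n).numLevels := by
  filter_upwards [(h c hc).eventually_lt_const one_pos] with n hn
  by_contra! hlt
  have h0 : ((D n).numLevels : ℝ) * ((D n).numLevels - 1 : ℝ) = 0 := by
    have : (D n).numLevels = 0 ∨ (D n).numLevels = 1 := by omega
    rcases this with h | h <;> simp [h]
  simp [h0, abs_of_pos hc, Set.ofPred_true] at hn

/-- The deterministic part of the rate: on the event where the score, the observed information and
the tuning parameters are under control, all estimates lie in a ball of radius `C √(p / n)`. -/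
lemma argmins_within_rate {n : ℕ} (hn : 1 ≤ n) (hD : 2 ≤ D.numLevels) (T : Tuning D)
    (d : D.Sample n) (b : D.Params) (I : Matrix D.Idx D.Idx ℝ) {κ K C c₁ c₂ : ℝ} (hκ : 0 < κ)
    (hK : 0 ≤ K) (hC : 1 ≤ C) (hc₁ : 0 ≤ c₁) (hc₂ : 0 ≤ c₂)
    (hCK : 16 * (K + 2 * c₁ + 6 * c₂ + 1) ≤ κ * C)
    (hI : ∀ u : D.Params, κ * ‖u‖ ^ 2 ≤ ∑ a, ∑ c, u a * I a c * u c)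
    (hscore : ∑ a, (∑ i, score b (d i) a) ^ 2 ≤ K ^ 2 * (n * D.numLevels))
    (hinfo : ∑ q : D.Idx × D.Idx, (∑ i, information b (d i) q - n * I q.1 q.2) ^ 2 ≤
      (n * κ / 2) ^ 2)
    (hsmall : 2 * C ^ 2 * ((D.numLevels : ℝ) ^ 2 / n) ≤ 1)
    (h₁ : Real.sqrt (D.numLevels / n) * a1 T * D.J ≤ 2 * c₁)
    (h₂ : a0 T * (D.numLevels * (D.numLevels - 1 : ℝ)) ≤ 2 * c₂) :
    (argmins T d).Nonempty ∧
      ∀ m ∈ argmins T d, ‖m - b‖ ≤ C * Real.sqrt (D.numLevels / n) := by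
  have hn' : (0 : ℝ) < n := by exact_mod_cast hn
  have hp : (2 : ℝ) ≤ D.numLevels := by exact_mod_cast hD
  have hcard : (Fintype.card D.Idx : ℝ) ≤ 2 * D.numLevels := by
    exact_mod_cast card_idx_le (by omega : 1 ≤ D.numLevels)
  set p : ℝ := (D.numLevels : ℝ)
  set α := Real.sqrt (p / n)
  have hα : 0 < α := Real.sqrt_pos.2 (by positivity)
  have hα2 : α ^ 2 = p / n := Real.sq_sqrt (by positivity)
  have hnα : n * α ^ 2 = p := by rw [hα2]; field_simp
  have hsα : Real.sqrt (n * p) * α = p := by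
    rw [← Real.sqrt_mul (by positivity)]
    have : n * p * (p / n) = p ^ 2 := by field_simp
    rw [this, Real.sqrt_sq (by linarith)]
  refine argmins_of_score_of_information T d b I hκ.le (s := K * Real.sqrt (n * p)) (by positivity)
    hI ?_ hinfo (by positivity) ?_ ?_
  · rwa [mul_pow, Real.sq_sqrt (by positivity)]
  · refine (abs_le_one_iff_mul_self_le_one.2 ?_ |> (le_abs_self _).trans)
    rw [← sq, mul_pow, mul_pow, Real.sq_sqrt (by positivity), hα2]
    calc (Fintype.card D.Idx : ℝ) * (C ^ 2 * (p / n)) ≤ 2 * p * (C ^ 2 * (p / n)) := by gcongr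
      _ = 2 * C ^ 2 * (p ^ 2 / n) := by ring
      _ ≤ 1 := hsmall
  · have hf : fusionPart T b ≤ 6 * c₂ := by
      refine (fusionPart_le T b).trans ?_
      -- `p² + p ≤ 3p(p-1)` is equivalent to `p ≥ 2` for positive `p`.
      have : a0 T * (p ^ 2 + p) ≤ a0 T * (3 * (p * (p - 1))) :=
        mul_le_mul_of_nonneg_left (by nlinarith) (a0_nonneg T)
      linarith
    have e1 : n * κ * (C * α) ^ 2 / 16 = κ * C * (C * p) / 16 := by
      linear_combination κ * C ^ 2 / 16 * hnα
    have e2 : K * Real.sqrt (n * p) * (C * α) = K * (C * p) := by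
      linear_combination K * C * hsα
    have e3 : a1 T * D.J * (C * α) ≤ 2 * c₁ * C := by
      calc _ = α * a1 T * D.J * C := by ring
        _ ≤ _ := mul_le_mul_of_nonneg_right h₁ (by linarith)
    rw [e1, e2]
    have hCp : C ≤ C * p := by nlinarith
    have h3 := mul_le_mul_of_nonneg_right hCK (by positivity : 0 ≤ C * p)
    have h4 := mul_le_mul_of_nonneg_left hCp (by positivity : 0 ≤ 2 * c₁ + 6 * c₂ + 1)
    have h5 := mul_le_mul_of_nonneg_left hC (by positivity : 0 ≤ 6 * c₂ + 1)
    linarith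

/-- Up to a small probability, an estimate exists, and all of them are close to the parameter. -/
lemma exists_rate_bound
    (D : ℕ → Design)
    (μ : ∀ n, Measure (D n).Covariates)
    [∀ n, IsProbabilityMeasure (μ n)]
    (βs : ∀ n, (D n).Params)
    (T : ∀ n, (D n).Sample n → Tuning (D n))
    (κ : ℝ) (hκ : 0 < κ)
    (hFisher : ∀ n, ∀ u : (D n).Params,
      κ * ‖u‖ ^ 2 ≤ ∑ a, ∑ b, u a * fisherInfo (μ n) (βs n) a b * u b)
    (c₁ c₂ : ℝ) (hc₁ : 0 < c₁) (hc₂ : 0 < c₂)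
    (h₁ : TendstoInProb (fun n => sampleLaw (μ n) (βs n) n)
      (fun n d => Real.sqrt ((D n).numLevels / n) * a1 (T n d) * (D n).J) c₁)
    (h₂ : TendstoInProb (fun n => sampleLaw (μ n) (βs n) n)
      (fun n d => a0 (T n d) * ((D n).numLevels * ((D n).numLevels - 1 : ℝ))) c₂)
    (hp : Tendsto (fun n : ℕ => ((D n).numLevels : ℝ) ^ 4 / n) atTop (𝓝 0))
    {ε : ℝ} (hε : 0 < ε) :
    ∃ C : ℝ, ∀ᶠ n in atTop, sampleLaw (μ n) (βs n) n
      {d | ¬ ((argmins (T n d) d).Nonempty ∧ ∀ m ∈ argmins (T n d) d,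
        ‖m - βs n‖ ≤ C * Real.sqrt ((D n).numLevels / n))} ≤ ENNReal.ofReal ε := by
  -- The score exceeds `K √(np)` with probability at most `2/K² = ε/4`, as there are at most `2p`
  -- coefficients.
  set K := Real.sqrt (8 / ε)
  have hK2 : K ^ 2 = 8 / ε := Real.sq_sqrt (by positivity)
  have hK : 0 < K := Real.sqrt_pos.2 (by positivity)
  -- The leading `1` ensures `C ≥ 1`; the `1` in the bracket makes the sphere inequality strict.
  set C := 1 + 16 * (K + 2 * c₁ + 6 * c₂ + 1) / κ
  have hC : 1 ≤ C := le_add_of_nonneg_right (by positivity)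
  have hCK : 16 * (K + 2 * c₁ + 6 * c₂ + 1) ≤ κ * C := by
    have : κ * C = κ + 16 * (K + 2 * c₁ + 6 * c₂ + 1) := by simp only [C]; field_simp
    linarith
  have hp2 := tendsto_sq_div_of_pow_four hp
  have hε4 : (0 : ENNReal) < ENNReal.ofReal (ε / 4) := ENNReal.ofReal_pos.2 (by positivity)
  refine ⟨C, ?_⟩
  -- Four events of probability at most `ε/4` are excluded. Deviations `c₁` and `c₂` bound the
  -- tuning quantities by `2c₁` and `2c₂`; the last threshold turns the information bound
  -- `16p²/(nκ²)` into `ε/4`.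
  filter_upwards [eventually_two_le_numLevels _ hc₂ h₂, eventually_ge_atTop 1,
    (h₁ c₁ hc₁).eventually_le_const hε4, (h₂ c₂ hc₂).eventually_le_const hε4,
    hp2.eventually_le_const (by positivity : 0 < 1 / (2 * C ^ 2)),
    hp2.eventually_le_const (by positivity : 0 < ε * κ ^ 2 / 64)] with n hD hn hB₁ hB₂ hs hi
  have hn' : (0 : ℝ) < n := by exact_mod_cast hn
  have hp0 : (2 : ℝ) ≤ (D n).numLevels := by exact_mod_cast hD
  have hcard : (Fintype.card (D n).Idx : ℝ) ≤ 2 * (D n).numLevels := by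
    exact_mod_cast card_idx_le (by omega : 1 ≤ (D n).numLevels)
  have hsmall : 2 * C ^ 2 * (((D n).numLevels : ℝ) ^ 2 / n) ≤ 1 := by
    rw [le_div_iff₀ (by positivity)] at hs
    linarith
  have hB₃ := (sampleLaw_score_ge_le (μ n) (βs n) n
    (t := K ^ 2 * (n * (D n).numLevels)) (by positivity)).trans
    (ENNReal.ofReal_le_ofReal (q := ε / 4) (by
      rw [div_le_iff₀ (by positivity), hK2]
      have : ε / 4 * (8 / ε * (n * (D n).numLevels)) = 2 * (D n).numLevels * n := by
        field_simp; norm_num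
      rw [this]
      gcongr))
  have hB₄ := (sampleLaw_information_ge_le (μ n) (βs n) n
    (t := (n * κ / 2) ^ 2) (by positivity)).trans
    (ENNReal.ofReal_le_ofReal (q := ε / 4) (by
      rw [div_le_iff₀ (by positivity)]
      rw [div_le_iff₀ hn'] at hi
      calc (Fintype.card (D n).Idx : ℝ) ^ 2 * n ≤ (2 * (D n).numLevels) ^ 2 * n := by gcongr
        _ ≤ ε / 4 * (n * κ / 2) ^ 2 := by nlinarith [mul_le_mul_of_nonneg_right hi hn'.le]))
  refine (measure_mono (fun d hd => ?_)).trans ((measure_union_le _ _).trans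
    ((add_le_add ((measure_union_le _ _).trans (add_le_add hB₁ hB₂))
      ((measure_union_le _ _).trans (add_le_add hB₃ hB₄))).trans_eq ?_))
  · by_contra hgood
    simp only [Set.mem_union, Set.mem_ofPred_eq, not_or, not_le] at hgood
    obtain ⟨⟨g₁, g₂⟩, g₃, g₄⟩ := hgood
    refine hd (argmins_within_rate hn hD (T n d) d (βs n) _ hκ hK.le hC hc₁.le hc₂.le hCK
      (hFisher n) g₃.le g₄.le hsmall ?_ ?_)
    · linarith [(abs_lt.1 g₁).2]
    · linarith [(abs_lt.1 g₂).2]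
  · rw [← ENNReal.ofReal_add (by positivity) (by positivity),
      ← ENNReal.ofReal_add (by positivity) (by positivity)]
    ring_nf

end L0FGL

end

/-- Consistency of the `L₀`-fused group lasso with a diverging number of parameters. For each sample
size `n` there are a design `D n`, a law `μ n` of the covariates and a true parameter `βs n`. The
tuning parameters and weights `T n` may depend on the sample (constant functions of the sample are
the deterministic choices). -/
theorem theorem3p4
    (D : ℕ → Design)
    (μ : ∀ n, Measure (D n).Covariates)
    [∀ n, IsProbabilityMeasure (μ n)]
    (βs : ∀ n, (D n).Params)
    (T : ∀ n, (D n).Sample n → Tuning (D n))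
    -- the Fisher information at the true parameter is positive definite, uniformly in `n`
    (κ : ℝ) (hκ : 0 < κ)
    (hFisher : ∀ n, ∀ u : (D n).Params,
      κ * ‖u‖ ^ 2 ≤ ∑ a, ∑ b, u a * fisherInfo (μ n) (βs n) a b * u b)
    (c₁ c₂ : ℝ) (hc₁ : 0 < c₁) (hc₂ : 0 < c₂)
    (h₁ : TendstoInProb (fun n => sampleLaw (μ n) (βs n) n)
      (fun n d => Real.sqrt ((D n).numLevels / n) * a1 (T n d) * (D n).J) c₁)
    (h₂ : TendstoInProb (fun n => sampleLaw (μ n) (βs n) n)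
      (fun n d => a0 (T n d) * ((D n).numLevels * ((D n).numLevels - 1 : ℝ))) c₂)
    (hp : Tendsto (fun n : ℕ => ((D n).numLevels : ℝ) ^ 4 / n) atTop (𝓝 0)) :
    -- an estimator that minimizes the objective whenever it has a minimizer, which is the case
    -- with probability tending to one, and that has the rate `√(p_n / n)`
    ∃ βhat : ∀ n, (D n).Sample n → (D n).Params,
      (∀ n d, (argmins (T n d) d).Nonempty → βhat n d ∈ argmins (T n d) d) ∧
      Tendsto (fun n => sampleLaw (μ n) (βs n) n {d | βhat n d ∈ argmins (T n d) d})
        atTop (𝓝 1) ∧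
      IsBigOInProb (fun n => sampleLaw (μ n) (βs n) n)
        (fun n d => ‖βhat n d - βs n‖)
        (fun n => Real.sqrt ((D n).numLevels / n)) := by
  classical
  have key {ε : ℝ} (hε : 0 < ε) :=
    exists_rate_bound D μ βs T κ hκ hFisher c₁ c₂ hc₁ hc₂ h₁ h₂ hp hε
  have hex (n : ℕ) (d : (D n).Sample n) :
      ∃ m : (D n).Params, (argmins (T n d) d).Nonempty → m ∈ argmins (T n d) d := by
    by_cases h : (argmins (T n d) d).Nonempty
    · exact ⟨h.some, fun _ => h.some_mem⟩
    -- Without a minimizer the value is arbitrary; such samples lie in the exceptional event.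
    · exact ⟨0, fun h' => absurd h' h⟩
  choose βhat hβ using hex
  refine ⟨βhat, hβ, ?_, fun ε hε => ?_⟩
  · have h0 : Tendsto (fun n => sampleLaw (μ n) (βs n) n {d | βhat n d ∈ argmins (T n d) d}ᶜ)
        atTop (𝓝 0) := by
      rw [ENNReal.tendsto_nhds_zero]
      intro δ hδ
      obtain ⟨ε, hε, hεδ⟩ : ∃ ε : ℝ, 0 < ε ∧ ENNReal.ofReal ε ≤ δ := by
        rcases eq_or_ne δ ⊤ with rfl | hδt
        · exact ⟨1, one_pos, le_top⟩
        · exact ⟨δ.toReal, ENNReal.toReal_pos hδ.ne' hδt, ENNReal.ofReal_toReal_le⟩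
      obtain ⟨C, hC⟩ := key hε
      filter_upwards [hC] with n hn
      refine (measure_mono ?_).trans (hn.trans hεδ)
      exact fun d hd h => hd (hβ n d h.1)
    have h1 := ENNReal.Tendsto.sub (tendsto_const_nhds (x := (1 : ENNReal))) h0
      (Or.inl ENNReal.one_ne_top)
    rw [tsub_zero] at h1
    refine h1.congr fun n => ?_
    rw [← prob_compl_eq_one_sub (MeasurableSet.of_discrete), compl_compl]
  · obtain ⟨C, hC⟩ := key hε
    refine ⟨C, ?_⟩
    filter_upwards [hC] with n hn
    refine (measure_mono ?_).trans hn
    intro d hd h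
    rw [Set.mem_ofPred_eq, abs_norm] at hd
    exact hd.not_ge (h.2 _ (hβ n d h.1))
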